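/- Let $A$ be a finite alphabet and let $A^*$ be the set of finite strings over $A$. Partial functions $A^* \to A^*$ form a monoid under composition, with the total identity function as identity element. A partial function $f : A^* \to A^*$ is polynomially balanced if there is a polynomial $p$ such that $|f(x)| \le p(|x|)$ and $|x| \le p(|f(x)|)$ for all $x \in \mathrm{Dom}(f)$. Let $\mathsf{fP}$ be the set of all partial functions $A^* \to A^*$ that are polynomially balanced and computable by a deterministic polynomial-time Turing machine (which, on input $x$, accepts with output $f(x)$ if $x \in \mathrm{Dom}(f)$, and rejects otherwise). A function $g$ is an inverse of $f$ if $f \circ g \circ f = f$, and a mutual inverse of $f$ if in addition $g \circ f \circ g = g$. An element $f \in \mathsf{fP}$ is regular if it has an inverse in $\mathsf{fP}$. Let $\mathsf{invfP}$ be the set of all regular elements $f$ of $\mathsf{fP}$ that are injective on $\mathrm{Dom}(f)$. Then $\mathsf{invfP}$ is an inverse monoid under composition; that is, it contains the identity function, it is closed under composition, and every $f \in \mathsf{invfP}$ has exactly one mutual inverse in $\mathsf{invfP}$. Moreover, every regular element of $\mathsf{fP}$ has an inverse in $\mathsf{invfP}$. -/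

import Mathlib

/-- Partial functions `α → α` form a monoid: `f * g` is the composite `f ∘ g` of partial functions
(defined at `x` iff `g` is defined at `x` and `f` is defined at `g x`), and `1` is the identity. -/
instance partialFunctionMonoid {α : Type*} : Monoid (α →. α) where
  mul f g := f.comp g
  one := PFun.id α
  mul_assoc f g h := PFun.comp_assoc f g h
  one_mul f := PFun.id_comp f
  mul_one f := PFun.comp_id f

/-- `g` is an inverse of `f`, i.e. `f g f = f`. -/
def IsInverseOf {S : Type*} [Mul S] (g f : S) : Prop :=
  f * g * f = f

/-- `g` is a mutual inverse of `f`, i.e. `f g f = f` and `g f g = g`. -/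
def IsMutualInverseOf {S : Type*} [Mul S] (g f : S) : Prop :=
  IsInverseOf g f ∧ IsInverseOf f g

/-- `f` is a regular element of `T`: it lies in `T` and has an inverse in `T`. -/
def IsRegularElementOf {S : Type*} [Mul S] (T : Set S) (f : S) : Prop :=
  f ∈ T ∧ ∃ g ∈ T, IsInverseOf g f

/-- A monoid is an inverse monoid iff each of its elements has exactly one mutual inverse. -/
def IsInverseMonoid (S : Type*) [Monoid S] : Prop :=
  ∀ f : S, ∃! g : S, IsMutualInverseOf g f

/-- Injectivity of a partial function (on its domain). -/
def PartialInjective {α β : Type*} (f : α →. β) : Prop :=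
  ∀ ⦃x₁ x₂ : α⦄ ⦃y : β⦄, y ∈ f x₁ → y ∈ f x₂ → x₁ = x₂

/-- `f` is polynomially balanced: for some polynomial `p`, `|f(x)| ≤ p(|x|)` and `|x| ≤ p(|f(x)|)`
for all `x` in the domain of `f`. -/
def PolynomiallyBalanced {A : Type} (f : List A →. List A) : Prop :=
  ∃ p : Polynomial ℕ, ∀ x y : List A, y ∈ f x →
    y.length ≤ p.eval x.length ∧ x.length ≤ p.eval y.length

/-- `f` is computable by a deterministic polynomial-time Turing machine. The machine `M.tm` is
started with `x` as its only data. After at most `p(|x|)` steps it halts (`c.l = none`) in some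
configuration `c`, and the value of its finite memory in `c` either accepts or rejects. If it
accepts, then `f(x)` is defined and is the string on the output stack; if it rejects, then `f(x)`
is undefined. -/
def PolyTimeComputable {A : Type} (f : List A →. List A) : Prop :=
  ∃ (M : Turing.TM2ComputableAux A A) (accept : Set M.tm.σ) (p : Polynomial ℕ),
    ∀ x : List A, ∃ c : M.tm.Cfg,
      Nonempty (StateTransition.EvalsToInTime M.tm.step
        (Turing.initList M.tm (x.map M.inputAlphabet.symm)) (some c) (p.eval x.length)) ∧
      c.l = none ∧
      ∀ y : List A, y ∈ f x ↔
        c.var ∈ accept ∧ c.stk M.tm.k₁ = y.map M.outputAlphabet.symm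

/-- The set `fP` of the partial functions `A* → A*` that are polynomially balanced and computable
by a deterministic polynomial-time Turing machine. -/
def fP (A : Type) : Set (List A →. List A) :=
  {f | PolynomiallyBalanced f ∧ PolyTimeComputable f}

/-- The set `invfP` of the injective regular elements of `fP`. -/
def invfP (A : Type) : Set (List A →. List A) :=
  {f | PartialInjective f ∧ IsRegularElementOf (fP A) f}

/-! Given an inverse `g` of `f` in `fP`, restrict `g` to those `y` with `f (g y) = y`; this is
`sectionOf f g`. The restriction keeps the preimages that `g` chooses for the values of `f`, so it
is a mutual inverse of `f`. It is injective because `f` is single-valued, and balanced because `g`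
is. A machine for it computes `x = g y`, then `f x`, compares the result with `y`, and outputs a
stored copy of `x`. Polynomial time survives because balance bounds `|x|` by a polynomial in `|y|`
(`exists_two_stage_run`, `PolyTimeComputable.restrict`).

The rest is algebra. For injective `f` and `g`, being mutual inverses means being converse relations
(`IsMutualInverseOf.mem_iff`), which gives uniqueness. If `f'` and `g'` are inverses of `f` and `g`,
then `g' * f'` is an inverse of `f * g`, because injectivity of `f` forces `f'` to undo `f` exactly.
Closure of `fP` under composition comes from the same two-stage machine without the comparison. -/

open Turing StateTransition

/-! ### Bounded reachability -/

/-- `f` leads from `a` to `b` in at most `n` steps. -/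
def ReachesWithin {σ : Type*} (f : σ → Option σ) (n : ℕ) (a b : σ) : Prop :=
  Nonempty (EvalsToInTime f a (some b) n)

namespace ReachesWithin

variable {σ τ : Type*} {f : σ → Option σ} {g : τ → Option τ} {a b c : σ} {m n : ℕ}

theorem trans (h₁ : ReachesWithin f m a b) (h₂ : ReachesWithin f n b c) :
    ReachesWithin f (m + n) a c := by
  obtain ⟨h₁⟩ := h₁
  obtain ⟨h₂⟩ := h₂
  rw [add_comm]
  exact ⟨EvalsToInTime.trans f m n a b _ h₁ h₂⟩

theorem mono (h : ReachesWithin f m a b) (hmn : m ≤ n) : ReachesWithin f n a b := by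
  obtain ⟨h⟩ := h
  exact ⟨⟨h.toEvalsTo, h.steps_le_m.trans hmn⟩⟩

theorem single (h : f a = some b) : ReachesWithin f 1 a b :=
  ⟨⟨⟨1, h⟩, le_rfl⟩⟩

theorem head (h : f a = some b) (h' : ReachesWithin f n b c) : ReachesWithin f (n + 1) a c :=
  ((single h).trans h').mono (by omega)

/-- Only steps that actually occur have to be simulated, so `φ` may send a halted state to one that
continues. -/
theorem map (φ : σ → τ) (hφ : ∀ a b, f a = some b → g (φ a) = some (φ b))
    (h : ReachesWithin f n a b) : ReachesWithin g n (φ a) (φ b) := by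
  obtain ⟨⟨⟨k, hk⟩, hkn⟩⟩ := h
  refine ⟨⟨⟨k, ?_⟩, hkn⟩⟩
  clear hkn
  induction k generalizing b with
  | zero =>
    cases hk
    rfl
  | succ k ih =>
    rw [Function.iterate_succ_apply'] at hk ⊢
    cases hc : (flip bind f)^[k] (some a) with
    | none =>
      rw [hc] at hk
      cases hk
    | some c =>
      rw [hc] at hk
      rw [ih hc]
      exact hφ c b hk

end ReachesWithin

theorem Turing.initList_eq (tm : FinTM2) (s : List (tm.Γ tm.k₀)) :
    initList tm s =
      (⟨some tm.main, tm.initialState, Function.update (fun _ => []) tm.k₀ s⟩ : tm.Cfg) := by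
  unfold initList
  congr 1
  funext k
  by_cases h : k = tm.k₀
  · subst h
    simp
  · simp [h]

/-! ### Embedding a program into a larger machine -/

namespace Turing.TM2

variable {K K' : Type*} {Γ : K → Type*} {Λ Λ' σ σ' : Type*}

/-- The statement `q` acting on the stacks `ι k` and on the part of the memory that is read by `get`
and written by `set`. The label `l` becomes `lab (some l)`, and halting becomes a jump to
`lab none`. -/
def Stmt.embed (ι : K' → K) (get : σ → σ') (set : σ' → σ → σ) (lab : Option Λ' → Λ) :
    Stmt (fun k => Γ (ι k)) Λ' σ' → Stmt Γ Λ σ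
  | .push k f q => .push (ι k) (fun v => f (get v)) (q.embed ι get set lab)
  | .peek k f q => .peek (ι k) (fun v a => set (f (get v) a) v) (q.embed ι get set lab)
  | .pop k f q => .pop (ι k) (fun v a => set (f (get v) a) v) (q.embed ι get set lab)
  | .load f q => .load (fun v => set (f (get v)) v) (q.embed ι get set lab)
  | .branch p q₁ q₂ =>
    .branch (fun v => p (get v)) (q₁.embed ι get set lab) (q₂.embed ι get set lab)
  | .goto l => .goto fun v => lab (some (l (get v)))
  | .halt => .goto fun _ => lab none

/-- `V` and `T` fill in frozen values for the memory and stacks foreign to the small machine; the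
hypotheses say that reads and writes pass through this completion. -/
theorem stepAux_embed [DecidableEq K] [DecidableEq K'] {ι : K' → K} {get : σ → σ'}
    {set : σ' → σ → σ} {lab : Option Λ' → Λ} {V : σ' → σ}
    {T : (∀ k, List (Γ (ι k))) → ∀ k, List (Γ k)}
    (hget : ∀ v, get (V v) = v) (hset : ∀ v w, set w (V v) = V w)
    (hT : ∀ s k, T s (ι k) = s k)
    (hupd : ∀ s k x, Function.update (T s) (ι k) x = T (Function.update s k x))
    (q : Stmt (fun k => Γ (ι k)) Λ' σ') (v : σ') (s : ∀ k, List (Γ (ι k))) :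
    stepAux (q.embed ι get set lab) (V v) (T s) =
      ⟨some (lab (stepAux q v s).l), V (stepAux q v s).var, T (stepAux q v s).stk⟩ := by
  induction q generalizing v s with
  | push k f q ih => simp only [Stmt.embed, stepAux, hget, hT, hupd, ih]
  | peek k f q ih => simp only [Stmt.embed, stepAux, hget, hset, hT, ih]
  | pop k f q ih => simp only [Stmt.embed, stepAux, hget, hset, hT, hupd, ih]
  | load f q ih => simp only [Stmt.embed, stepAux, hget, hset, ih]
  | branch p q₁ q₂ ih₁ ih₂ =>
    simp only [Stmt.embed, stepAux, hget]
    cases p v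
    · exact ih₂ v s
    · exact ih₁ v s
  | goto l => simp only [Stmt.embed, stepAux, hget]
  | halt => simp only [Stmt.embed, stepAux]

theorem reachesWithin_embed [DecidableEq K] [DecidableEq K'] {ι : K' → K} {get : σ → σ'}
    {set : σ' → σ → σ} {lab : Option Λ' → Λ} {V : σ' → σ}
    {T : (∀ k, List (Γ (ι k))) → ∀ k, List (Γ k)}
    (hget : ∀ v, get (V v) = v) (hset : ∀ v w, set w (V v) = V w)
    (hT : ∀ s k, T s (ι k) = s k)
    (hupd : ∀ s k x, Function.update (T s) (ι k) x = T (Function.update s k x))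
    {m' : Λ' → Stmt (fun k => Γ (ι k)) Λ' σ'} {m : Λ → Stmt Γ Λ σ}
    (hm : ∀ l, m (lab (some l)) = (m' l).embed ι get set lab)
    {n : ℕ} {a b : Cfg (fun k => Γ (ι k)) Λ' σ'} (h : ReachesWithin (step m') n a b) :
    ReachesWithin (step m) n ⟨some (lab a.l), V a.var, T a.stk⟩
      ⟨some (lab b.l), V b.var, T b.stk⟩ := by
  refine h.map (fun c => (⟨some (lab c.l), V c.var, T c.stk⟩ : Cfg Γ Λ σ)) ?_
  rintro ⟨_ | l, v, s⟩ b hb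
  -- A halted configuration has no step to simulate, although its image continues at `lab none`.
  · cases hb
  · cases hb
    simp only [step, hm, stepAux_embed hget hset hT hupd]

end Turing.TM2

/-! ### Running one machine after another -/

namespace TwoStage

open Function TM2

variable {A : Type} (M₁ M₂ : TM2ComputableAux A A)

/-- The stacks: those of both machines, and four stacks over `A`. -/
abbrev Index : Type := M₁.tm.K ⊕ M₂.tm.K ⊕ Fin 4

/-- The stack alphabets. -/
abbrev Alphabet : Index M₁ M₂ → Type
  | .inl k => M₁.tm.Γ k
  | .inr (.inl k) => M₂.tm.Γ k
  | .inr (.inr _) => A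

/-- The memory: those of both machines, and two buffers for single letters. -/
abbrev Memory : Type := M₁.tm.σ × M₂.tm.σ × Option A × Option A

/-- The labels: those of both machines, and five labels for the phases around them. -/
abbrev Label : Type := M₁.tm.Λ ⊕ M₂.tm.Λ ⊕ Fin 5

/-- The contents of all stacks: `s₁`, `s₂` on the stacks of the two machines, the unread part `i`
of the input, the stack `t` used for reversing, and the copies `y` and `x` of the inputs of the two
machines. -/
def contents {M₁ M₂ : TM2ComputableAux A A} (s₁ : ∀ k, List (M₁.tm.Γ k))
    (s₂ : ∀ k, List (M₂.tm.Γ k)) (i t y x : List A) : ∀ k, List (Alphabet M₁ M₂ k)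
  | .inl k => s₁ k
  | .inr (.inl k) => s₂ k
  | .inr (.inr 0) => i
  | .inr (.inr 1) => t
  | .inr (.inr 2) => y
  | .inr (.inr 3) => x

/-! ### Overwriting a single stack -/

section Stacks

variable {M₁ M₂} (s₁ : ∀ k, List (M₁.tm.Γ k)) (s₂ : ∀ k, List (M₂.tm.Γ k)) (i t y x l : List A)

@[simp] theorem contents_fst (k) : contents s₁ s₂ i t y x (.inl k) = s₁ k := rfl

@[simp] theorem contents_snd (k) : contents s₁ s₂ i t y x (.inr (.inl k)) = s₂ k := rfl

@[simp] theorem contents_zero : contents s₁ s₂ i t y x (.inr (.inr 0)) = i := rfl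

@[simp] theorem contents_one : contents s₁ s₂ i t y x (.inr (.inr 1)) = t := rfl

@[simp] theorem contents_two : contents s₁ s₂ i t y x (.inr (.inr 2)) = y := rfl

@[simp] theorem contents_three : contents s₁ s₂ i t y x (.inr (.inr 3)) = x := rfl

@[simp] theorem update_contents_fst (k) (l : List (M₁.tm.Γ k)) :
    update (contents s₁ s₂ i t y x) (.inl k) l = contents (update s₁ k l) s₂ i t y x := by
  funext j
  rcases j with j | j | j
  · by_cases h : j = k
    · subst h
      simp
    · simp [h]
  · simp
  · fin_cases j <;> simp

@[simp] theorem update_contents_snd (k) (l : List (M₂.tm.Γ k)) :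
    update (contents s₁ s₂ i t y x) (.inr (.inl k)) l = contents s₁ (update s₂ k l) i t y x := by
  funext j
  rcases j with j | j | j
  · simp
  · by_cases h : j = k
    · subst h
      simp
    · simp [h]
  · fin_cases j <;> simp

@[simp] theorem update_contents_zero :
    update (contents s₁ s₂ i t y x) (.inr (.inr 0)) l = contents s₁ s₂ l t y x := by
  funext j
  rcases j with j | j | j
  · simp
  · simp
  · fin_cases j <;> simp

@[simp] theorem update_contents_one :
    update (contents s₁ s₂ i t y x) (.inr (.inr 1)) l = contents s₁ s₂ i l y x := by
  funext j
  rcases j with j | j | j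
  · simp
  · simp
  · fin_cases j <;> simp

@[simp] theorem update_contents_two :
    update (contents s₁ s₂ i t y x) (.inr (.inr 2)) l = contents s₁ s₂ i t l x := by
  funext j
  rcases j with j | j | j
  · simp
  · simp
  · fin_cases j <;> simp

@[simp] theorem update_contents_three :
    update (contents s₁ s₂ i t y x) (.inr (.inr 3)) l = contents s₁ s₂ i t y l := by
  funext j
  rcases j with j | j | j
  · simp
  · simp
  · fin_cases j <;> simp

end Stacks

/-- Push the letter `a` in the first buffer, encoded as `e a`, on the stack `k`. -/
noncomputable def pushLetter {M₁ M₂ : TM2ComputableAux A A} (k : Index M₁ M₂)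
    (e : A → Alphabet M₁ M₂ k) (q : Stmt (Alphabet M₁ M₂) (Label M₁ M₂) (Memory M₁ M₂)) :
    Stmt (Alphabet M₁ M₂) (Label M₁ M₂) (Memory M₁ M₂) :=
  open Classical in
  -- A push must supply a letter for every memory value, even with an empty buffer, hence the
  -- default; if `A` is empty there is never a letter to push.
  if h : Nonempty A then .push k (fun v => e (v.2.2.1.getD h.some)) q else q

@[simp] theorem stepAux_pushLetter {M₁ M₂ : TM2ComputableAux A A} (k : Index M₁ M₂)
    (e : A → Alphabet M₁ M₂ k) (q : Stmt (Alphabet M₁ M₂) (Label M₁ M₂) (Memory M₁ M₂))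
    (v₁ : M₁.tm.σ) (v₂ : M₂.tm.σ) (a : A) (b : Option A) (S : ∀ k, List (Alphabet M₁ M₂ k)) :
    stepAux (pushLetter k e q) (v₁, v₂, some a, b) S =
      stepAux q (v₁, v₂, some a, b) (update S k (e a :: S k)) := by
  rw [pushLetter, dif_pos ⟨a⟩]
  rfl

open Classical in
/-- The program. Phases `0` and `1` copy the input to the input stack of `M₁`, phases `2` and `3`
copy the output of `M₁`, if accepted, to the input stack of `M₂`. If `check` is set, then phase `4`
compares the input with the output of `M₂`. -/
noncomputable def program (accept₁ : Set M₁.tm.σ) (check : Bool) :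
    Label M₁ M₂ → Stmt (Alphabet M₁ M₂) (Label M₁ M₂) (Memory M₁ M₂)
  | .inl l =>
    Stmt.embed (Γ := Alphabet M₁ M₂) .inl (fun v => v.1) (fun w v => (w, v.2))
      (fun o => o.elim (.inr (.inr 2)) .inl) (M₁.tm.m l)
  | .inr (.inl l) =>
    Stmt.embed (Γ := Alphabet M₁ M₂) (fun k => .inr (.inl k)) (fun v => v.2.1)
      (fun w v => (v.1, w, v.2.2))
      (fun o => o.elim (.inr (.inr 4)) fun l => .inr (.inl l)) (M₂.tm.m l)
  | .inr (.inr 0) =>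
    .pop (.inr (.inr 0)) (fun v a => (v.1, v.2.1, a, v.2.2.2)) <|
    .branch (fun v => v.2.2.1.isSome)
      (pushLetter (.inr (.inr 1)) id <| .goto fun _ => .inr (.inr 0))
      (.goto fun _ => .inr (.inr 1))
  | .inr (.inr 1) =>
    .pop (.inr (.inr 1)) (fun v a => (v.1, v.2.1, a, v.2.2.2)) <|
    .branch (fun v => v.2.2.1.isSome)
      (pushLetter (.inl M₁.tm.k₀) M₁.inputAlphabet.symm <|
        pushLetter (.inr (.inr 2)) id <| .goto fun _ => .inr (.inr 1))
      (.goto fun _ => .inl M₁.tm.main)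
  | .inr (.inr 2) =>
    .branch (fun v => v.1 ∈ accept₁)
      (.pop (.inl M₁.tm.k₁) (fun v a => (v.1, v.2.1, a.map M₁.outputAlphabet, v.2.2.2)) <|
        .branch (fun v => v.2.2.1.isSome)
          (pushLetter (.inr (.inr 1)) id <| .goto fun _ => .inr (.inr 2))
          (.goto fun _ => .inr (.inr 3)))
      .halt
  | .inr (.inr 3) =>
    .pop (.inr (.inr 1)) (fun v a => (v.1, v.2.1, a, v.2.2.2)) <|
    .branch (fun v => v.2.2.1.isSome)
      (pushLetter (.inr (.inl M₂.tm.k₀)) M₂.inputAlphabet.symm <|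
        pushLetter (.inr (.inr 3)) id <| .goto fun _ => .inr (.inr 3))
      (.goto fun _ => .inr (.inl M₂.tm.main))
  | .inr (.inr 4) =>
    if check then
      .pop (.inr (.inr 2)) (fun v a => (v.1, v.2.1, a, v.2.2.2)) <|
      .pop (.inr (.inl M₂.tm.k₁)) (fun v a => (v.1, v.2.1, v.2.2.1, a.map M₂.outputAlphabet)) <|
      .branch (fun v => v.2.2.1.isSome ∧ v.2.2.1 = v.2.2.2)
        (.goto fun _ => .inr (.inr 4))
        .halt
    else .halt

/-! ### Step counts of the phases -/

section Run

variable {M₁ M₂} {accept₁ : Set M₁.tm.σ} {check : Bool} (v₁ : M₁.tm.σ) (v₂ : M₂.tm.σ)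
  (b₁ b₂ : Option A) (s₁ : ∀ k, List (M₁.tm.Γ k)) (s₂ : ∀ k, List (M₂.tm.Γ k)) (l t y x r : List A)

/-- The configurations. -/
abbrev Config (M₁ M₂ : TM2ComputableAux A A) : Type :=
  Cfg (Alphabet M₁ M₂) (Label M₁ M₂) (Memory M₁ M₂)

/-- Moving a word from stack to stack reverses it; the next phase reverses it back. The extra step
is the pop that finds the stack empty. -/
theorem reaches_read_input :
    ReachesWithin (step (program M₁ M₂ accept₁ check)) (l.length + 1)
      (⟨some (.inr (.inr 0)), (v₁, v₂, b₁, b₂), contents s₁ s₂ l t y x⟩ : Config M₁ M₂)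
      ⟨some (.inr (.inr 1)), (v₁, v₂, none, b₂), contents s₁ s₂ [] (l.reverse ++ t) y x⟩ := by
  induction l generalizing t b₁ with
  | nil => exact .single (by simp [program])
  | cons a l ih =>
    have h := ih (some a) (a :: t)
    rw [List.append_cons, ← List.reverse_cons] at h
    refine .head ?_ h
    simp [program]

theorem reaches_feed_fst :
    ReachesWithin (step (program M₁ M₂ accept₁ check)) (l.length + 1)
      (⟨some (.inr (.inr 1)), (v₁, v₂, b₁, b₂), contents s₁ s₂ t l y x⟩ : Config M₁ M₂)
      ⟨some (.inl M₁.tm.main), (v₁, v₂, none, b₂),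
        contents (update s₁ M₁.tm.k₀ (l.reverse.map M₁.inputAlphabet.symm ++ s₁ M₁.tm.k₀)) s₂ t []
          (l.reverse ++ y) x⟩ := by
  induction l generalizing s₁ y b₁ with
  | nil => exact .single (by simp [program])
  | cons a l ih =>
    have h := ih (some a)
      (update s₁ M₁.tm.k₀ (M₁.inputAlphabet.symm a :: s₁ M₁.tm.k₀)) (a :: y)
    rw [update_idem, update_self, List.append_cons (List.reverse l), ← List.reverse_cons,
      List.append_cons (List.map _ _), ← List.map_singleton (f := M₁.inputAlphabet.symm),
      ← List.map_append, ← List.reverse_cons] at h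
    refine .head ?_ h
    simp [program]

theorem reaches_feed_snd :
    ReachesWithin (step (program M₁ M₂ accept₁ check)) (l.length + 1)
      (⟨some (.inr (.inr 3)), (v₁, v₂, b₁, b₂), contents s₁ s₂ t l y x⟩ : Config M₁ M₂)
      ⟨some (.inr (.inl M₂.tm.main)), (v₁, v₂, none, b₂),
        contents s₁ (update s₂ M₂.tm.k₀ (l.reverse.map M₂.inputAlphabet.symm ++ s₂ M₂.tm.k₀)) t []
          y (l.reverse ++ x)⟩ := by
  induction l generalizing s₂ x b₁ with
  | nil => exact .single (by simp [program])
  | cons a l ih =>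
    have h := ih (some a)
      (update s₂ M₂.tm.k₀ (M₂.inputAlphabet.symm a :: s₂ M₂.tm.k₀)) (a :: x)
    rw [update_idem, update_self, List.append_cons (List.reverse l), ← List.reverse_cons,
      List.append_cons (List.map _ _), ← List.map_singleton (f := M₂.inputAlphabet.symm),
      ← List.map_append, ← List.reverse_cons] at h
    refine .head ?_ h
    simp [program]

variable {v₁} in
theorem reaches_read_output (hv : v₁ ∈ accept₁)
    (hs : s₁ M₁.tm.k₁ = l.map M₁.outputAlphabet.symm) :
    ReachesWithin (step (program M₁ M₂ accept₁ check)) (l.length + 1)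
      (⟨some (.inr (.inr 2)), (v₁, v₂, b₁, b₂), contents s₁ s₂ y t x r⟩ : Config M₁ M₂)
      ⟨some (.inr (.inr 3)), (v₁, v₂, none, b₂),
        contents (update s₁ M₁.tm.k₁ []) s₂ y (l.reverse ++ t) x r⟩ := by
  induction l generalizing s₁ t b₁ with
  | nil => exact .single (by simp_all [program])
  | cons a l ih =>
    have h := ih (some a) (update s₁ M₁.tm.k₁ (l.map M₁.outputAlphabet.symm)) (a :: t)
      (update_self ..)
    rw [update_idem, List.append_cons, ← List.reverse_cons] at h
    refine .head ?_ h
    simp [program, hv, hs]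

/-- Both words are popped in lockstep until the letters differ or the first word is exhausted. At
that moment both buffers are empty exactly if the words ended together. -/
theorem reaches_compare (l' : List A) (hs : s₂ M₂.tm.k₁ = l'.map M₂.outputAlphabet.symm) :
    ∃ c : Config M₁ M₂,
      ReachesWithin (step (program M₁ M₂ accept₁ true)) (l.length + 1)
        (⟨some (.inr (.inr 4)), (v₁, v₂, b₁, b₂), contents s₁ s₂ t y l x⟩ : Config M₁ M₂) c ∧
      c.l = none ∧ c.var.1 = v₁ ∧ c.var.2.1 = v₂ ∧
      (c.var.2.2.1 = none ∧ c.var.2.2.2 = none ↔ l = l') ∧ c.stk (.inr (.inr 3)) = x := by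
  induction l generalizing s₂ l' b₁ b₂ with
  | nil =>
    refine ⟨_, .single (by simp [program]; rfl), ?_⟩
    cases l' <;> simp [hs]
  | cons a l ih =>
    by_cases h : l'.head? = some a
    · obtain ⟨l', rfl⟩ : ∃ l'', l' = a :: l'' := by
        cases l' <;> simp_all
      obtain ⟨c, hc, h₁, h₂, h₃, h₄, h₅⟩ := ih (some a) (some a)
        (update s₂ M₂.tm.k₁ (l'.map M₂.outputAlphabet.symm)) l' (update_self ..)
      refine ⟨c, .head ?_ hc, h₁, h₂, h₃, ?_, h₅⟩
      · simp [program, hs]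
      · simpa using h₄
    · refine ⟨⟨none, (v₁, v₂, some a, l'.head?),
        contents s₁ (update s₂ M₂.tm.k₁ (s₂ M₂.tm.k₁).tail) t y l x⟩,
        (ReachesWithin.single ?_).mono (by simp), rfl, rfl, rfl, ?_, rfl⟩
      · simp [program, hs, Ne.symm h]
      · constructor
        · simp
        · rintro rfl
          exact (h rfl).elim

theorem reaches_run_fst {n : ℕ} {a b : M₁.tm.Cfg} (h : ReachesWithin M₁.tm.step n a b) :
    ReachesWithin (step (program M₁ M₂ accept₁ check)) n
      (⟨some (a.l.elim (.inr (.inr 2)) .inl), (a.var, v₂, b₁, b₂), contents a.stk s₂ l t y x⟩ :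
        Config M₁ M₂)
      ⟨some (b.l.elim (.inr (.inr 2)) .inl), (b.var, v₂, b₁, b₂), contents b.stk s₂ l t y x⟩ :=
  reachesWithin_embed (Γ := Alphabet M₁ M₂) (Λ := Label M₁ M₂) (σ := Memory M₁ M₂)
    (m := program M₁ M₂ accept₁ check) (m' := M₁.tm.m) (ι := .inl) (get := fun v => v.1)
    (set := fun w v => (w, v.2)) (lab := fun o => o.elim (.inr (.inr 2)) .inl)
    (V := fun v => (v, v₂, b₁, b₂)) (T := fun s => contents s s₂ l t y x)
    (fun _ => rfl) (fun _ _ => rfl) (fun _ _ => rfl)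
    (fun _ _ _ => update_contents_fst ..) (fun _ => rfl) h

theorem reaches_run_snd {n : ℕ} {a b : M₂.tm.Cfg} (h : ReachesWithin M₂.tm.step n a b) :
    ReachesWithin (step (program M₁ M₂ accept₁ check)) n
      (⟨some (a.l.elim (.inr (.inr 4)) fun l => .inr (.inl l)), (v₁, a.var, b₁, b₂),
        contents s₁ a.stk l t y x⟩ : Config M₁ M₂)
      ⟨some (b.l.elim (.inr (.inr 4)) fun l => .inr (.inl l)), (v₁, b.var, b₁, b₂),
        contents s₁ b.stk l t y x⟩ :=
  reachesWithin_embed (Γ := Alphabet M₁ M₂) (Λ := Label M₁ M₂) (σ := Memory M₁ M₂)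
    (m := program M₁ M₂ accept₁ check) (m' := M₂.tm.m) (ι := fun k => .inr (.inl k))
    (get := fun v => v.2.1)
    (set := fun w v => (v.1, w, v.2.2))
    (lab := fun o => o.elim (.inr (.inr 4)) fun l => .inr (.inl l))
    (V := fun v => (v₁, v, b₁, b₂)) (T := fun s => contents s₁ s l t y x)
    (fun _ => rfl) (fun _ _ => rfl) (fun _ _ => rfl)
    (fun _ _ _ => update_contents_snd ..) (fun _ => rfl) h

variable (M₁ M₂) in
/-- The initial configuration on input `y`. -/
def start : Config M₁ M₂ :=
  ⟨some (.inr (.inr 0)), (M₁.tm.initialState, M₂.tm.initialState, none, none),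
    contents (fun _ => []) (fun _ => []) y [] [] []⟩

theorem reaches_fst {n : ℕ} {c₁ : M₁.tm.Cfg} (hl : c₁.l = none)
    (h : ReachesWithin M₁.tm.step n (initList M₁.tm (y.map M₁.inputAlphabet.symm)) c₁) :
    ReachesWithin (step (program M₁ M₂ accept₁ check)) (2 * y.length + 2 + n) (start M₁ M₂ y)
      ⟨some (.inr (.inr 2)), (c₁.var, M₂.tm.initialState, none, none),
        contents c₁.stk (fun _ => []) [] [] y []⟩ := by
  have h₁ := reaches_read_input (accept₁ := accept₁) (check := check) M₁.tm.initialState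
    M₂.tm.initialState none none (fun _ => []) (fun _ => []) y [] [] []
  have h₂ := reaches_feed_fst (accept₁ := accept₁) (check := check) M₁.tm.initialState
    M₂.tm.initialState none none (fun _ => []) (fun _ => []) (y.reverse ++ []) [] [] []
  rw [initList_eq] at h
  have h₃ := reaches_run_fst (accept₁ := accept₁) (check := check)
    M₂.tm.initialState none none (fun _ => []) [] [] y [] h
  simp only [List.append_nil, List.reverse_reverse, List.length_reverse, hl, Option.elim_none,
    Option.elim_some] at h₁ h₂ h₃
  exact ((h₁.trans h₂).trans h₃).mono (by omega)

theorem reaches_reject {n : ℕ} {c₁ : M₁.tm.Cfg} (hl : c₁.l = none) (hv : c₁.var ∉ accept₁)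
    (h : ReachesWithin M₁.tm.step n (initList M₁.tm (y.map M₁.inputAlphabet.symm)) c₁) :
    ∃ c : Config M₁ M₂,
      ReachesWithin (step (program M₁ M₂ accept₁ check)) (2 * y.length + 3 + n) (start M₁ M₂ y) c ∧
      c.l = none ∧ c.var.1 ∉ accept₁ := by
  refine ⟨⟨none, (c₁.var, M₂.tm.initialState, none, none),
    contents c₁.stk (fun _ => []) [] [] y []⟩,
    ((reaches_fst y hl h).trans (.single ?_)).mono (by omega), rfl, hv⟩
  simp [program, hv]

theorem reaches_snd {n₁ n₂ : ℕ} {c₁ : M₁.tm.Cfg} {c₂ : M₂.tm.Cfg} (hl₁ : c₁.l = none)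
    (hv : c₁.var ∈ accept₁) (hx : c₁.stk M₁.tm.k₁ = x.map M₁.outputAlphabet.symm)
    (h₁ : ReachesWithin M₁.tm.step n₁ (initList M₁.tm (y.map M₁.inputAlphabet.symm)) c₁)
    (hl₂ : c₂.l = none)
    (h₂ : ReachesWithin M₂.tm.step n₂ (initList M₂.tm (x.map M₂.inputAlphabet.symm)) c₂) :
    ∃ s₁, ReachesWithin (step (program M₁ M₂ accept₁ check))
      (2 * y.length + 2 * x.length + 4 + n₁ + n₂) (start M₁ M₂ y)
      ⟨some (.inr (.inr 4)), (c₁.var, c₂.var, none, none), contents s₁ c₂.stk [] [] y x⟩ := by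
  have h := reaches_fst (M₂ := M₂) (accept₁ := accept₁) (check := check) y hl₁ h₁
  have h₃ := reaches_read_output (M₂ := M₂) (check := check) (M₂.tm.initialState) none none
    c₁.stk (fun _ => []) x [] [] y [] hv hx
  have h₄ := reaches_feed_snd (accept₁ := accept₁) (check := check) c₁.var
    M₂.tm.initialState none none (update c₁.stk M₁.tm.k₁ []) (fun _ => []) (x.reverse ++ []) []
    y []
  rw [initList_eq] at h₂
  have h₅ := reaches_run_snd (accept₁ := accept₁) (check := check)
    c₁.var none none (update c₁.stk M₁.tm.k₁ []) [] [] y x h₂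
  simp only [List.append_nil, List.reverse_reverse, List.length_reverse, hl₂, Option.elim_none,
    Option.elim_some] at h₃ h₄ h₅
  -- Four copying passes, two over `y` and two over `x`, each cost one step more than the word's
  -- length.
  exact ⟨_, (((h.trans h₃).trans h₄).trans h₅).mono (by omega)⟩

end Run

/-- The machine with program `program` and output stack `k₁`. -/
noncomputable def machine [Fintype A] (accept₁ : Set M₁.tm.σ) (check : Bool) (k₁ : Index M₁ M₂) : FinTM2 :=
  letI := M₁.tm.kFin
  letI := M₂.tm.kFin
  letI := M₁.tm.ΛFin
  letI := M₂.tm.ΛFin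
  letI := M₁.tm.σFin
  letI := M₂.tm.σFin
  { K := Index M₁ M₂
    k₀ := .inr (.inr 0)
    k₁ := k₁
    Γ := Alphabet M₁ M₂
    Λ := Label M₁ M₂
    main := .inr (.inr 0)
    σ := Memory M₁ M₂
    initialState := (M₁.tm.initialState, M₂.tm.initialState, none, none)
    m := program M₁ M₂ accept₁ check }

theorem initList_machine [Fintype A] (accept₁ : Set M₁.tm.σ) (check : Bool) (k₁ : Index M₁ M₂)
    (y : List A) : initList (machine M₁ M₂ accept₁ check k₁) y = start M₁ M₂ y := by
  refine (initList_eq (machine M₁ M₂ accept₁ check k₁) y).trans ?_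
  have h : (fun _ => []) =
      contents (M₁ := M₁) (M₂ := M₂) (fun _ => []) (fun _ => []) [] [] [] [] := by
    funext k
    rcases k with k | k | k
    · rfl
    · rfl
    · fin_cases k <;> rfl
  have h' := congrArg (fun S : ∀ k, List (Alphabet M₁ M₂ k) => update S (.inr (.inr 0)) y) h
  exact congrArg (Cfg.mk _ _) (h'.trans (update_contents_zero ..))

end TwoStage

/-! ### Closure properties of `fP` -/

theorem Polynomial.eval_mono_nat (p : Polynomial ℕ) : Monotone fun n => p.eval n := by
  intro m n h
  simp only [Polynomial.eval_eq_sum, Polynomial.sum]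
  gcongr

section PolyTime

open TwoStage TM2

variable {A : Type} {f g h : List A →. List A}

theorem mem_pfun_mul {x z : List A} : z ∈ (f * g) x ↔ ∃ y ∈ g x, z ∈ f y :=
  Part.mem_bind_iff

/-- The two-stage machines for `f` and `g` decide in polynomial time whether `g` is defined at `y`,
and if so, reach phase `4` with the results of the computations of `g y` and of `f (g y)`. -/
theorem exists_two_stage_run (hf : PolyTimeComputable f) (hg : g ∈ fP A) :
    ∃ (M₁ M₂ : TM2ComputableAux A A) (accept₁ : Set M₁.tm.σ) (accept₂ : Set M₂.tm.σ)
      (p : Polynomial ℕ), ∀ (check : Bool) (y : List A),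
      (g y = Part.none ∧ ∃ c : Config M₁ M₂,
        ReachesWithin (step (program M₁ M₂ accept₁ check)) (p.eval y.length) (start M₁ M₂ y) c ∧
        c.l = none ∧ c.var.1 ∉ accept₁) ∨
      ∃ x ∈ g y, ∃ v₁ v₂ s₁ s₂, v₁ ∈ accept₁ ∧
        ReachesWithin (step (program M₁ M₂ accept₁ check)) (p.eval y.length) (start M₁ M₂ y)
          ⟨some (.inr (.inr 4)), (v₁, v₂, none, none), contents s₁ s₂ [] [] y x⟩ ∧
        ∀ z, z ∈ f x ↔ v₂ ∈ accept₂ ∧ s₂ M₂.tm.k₁ = z.map M₂.outputAlphabet.symm := by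
  obtain ⟨M₂, accept₂, p₂, hM₂⟩ := hf
  obtain ⟨⟨q, hq⟩, M₁, accept₁, p₁, hM₁⟩ := hg
  -- Balance of `g` gives `|x| ≤ q(|y|)`; as `p₂` is monotone, the second run takes at most
  -- `p₂(q(|y|))` steps.
  refine ⟨M₁, M₂, accept₁, accept₂, 2 * .X + 2 * q + 4 + p₁ + p₂.comp q, fun check y => ?_⟩
  simp only [Polynomial.eval_add, Polynomial.eval_mul, Polynomial.eval_ofNat, Polynomial.eval_X,
    Polynomial.eval_comp]
  obtain ⟨c₁, hc₁, hl₁, hy₁⟩ := hM₁ y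
  by_cases hv : c₁.var ∈ accept₁
  · right
    obtain ⟨x, hx⟩ : ∃ x : List A, c₁.stk M₁.tm.k₁ = x.map M₁.outputAlphabet.symm :=
      ⟨(c₁.stk M₁.tm.k₁).map M₁.outputAlphabet, by simp⟩
    have hxy := (hy₁ x).2 ⟨hv, hx⟩
    obtain ⟨c₂, hc₂, hl₂, hy₂⟩ := hM₂ x
    obtain ⟨s₁, hs₁⟩ := reaches_snd (check := check) y x hl₁ hv hx hc₁ hl₂ hc₂
    have h₁ := (hq y x hxy).1
    have h₂ := p₂.eval_mono_nat h₁
    exact ⟨x, hxy, c₁.var, c₂.var, s₁, c₂.stk, hv, hs₁.mono (by dsimp only at h₂; omega), hy₂⟩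
  · left
    obtain ⟨c, hc, hl, hv'⟩ := reaches_reject (M₂ := M₂) (check := check) y hl₁ hv hc₁
    refine ⟨Part.eq_none_iff.2 fun x hx => hv ((hy₁ x).1 hx).1, c, hc.mono (by omega), hl, hv'⟩

theorem PolyTimeComputable.comp [Fintype A] (hf : PolyTimeComputable f) (hg : g ∈ fP A) :
    PolyTimeComputable (f * g) := by
  obtain ⟨M₁, M₂, accept₁, accept₂, p, hp⟩ := exists_two_stage_run hf hg
  refine ⟨⟨machine M₁ M₂ accept₁ false (.inr (.inl M₂.tm.k₁)), Equiv.refl A, M₂.outputAlphabet⟩,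
    -- Both verdicts are needed: if the first machine rejects, the second memory is still initial
    -- and might be accepting.
    {v | v.1 ∈ accept₁ ∧ v.2.1 ∈ accept₂}, p + 1, fun y => ?_⟩
  simp only [Polynomial.eval_add,
    Polynomial.eval_one, mem_pfun_mul]
  erw [List.map_id, initList_machine]
  obtain ⟨hy, c, hc, hl, hv⟩ | ⟨x, hx, v₁, v₂, s₁, s₂, hv, hc, hz⟩ := hp false y
  · refine ⟨c, hc.mono (by omega), hl, fun z => ?_⟩
    simp [hy, hv]
  · refine ⟨⟨none, (v₁, v₂, none, none), contents s₁ s₂ [] [] y x⟩, hc.trans (.single ?_), rfl,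
      fun z => ?_⟩
    · simp [program]
      rfl
    · constructor
      · rintro ⟨x', hx', hzx⟩
        obtain rfl := Part.mem_unique hx hx'
        obtain ⟨h₁, h₂⟩ := (hz z).1 hzx
        exact ⟨⟨hv, h₁⟩, h₂⟩
      · rintro ⟨⟨-, h₁⟩, h₂⟩
        exact ⟨x, hx, (hz z).2 ⟨h₁, h₂⟩⟩

/-- The output stack is the saved copy of `x = g y`, since the second machine's output serves only
for the comparison with `y`. -/
theorem PolyTimeComputable.restrict [Fintype A] (hf : PolyTimeComputable f) (hg : g ∈ fP A)
    (hh : ∀ y x, x ∈ h y ↔ x ∈ g y ∧ y ∈ f x) : PolyTimeComputable h := by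
  obtain ⟨M₁, M₂, accept₁, accept₂, p, hp⟩ := exists_two_stage_run hf hg
  refine ⟨⟨machine M₁ M₂ accept₁ true (.inr (.inr 3)), Equiv.refl A, Equiv.refl A⟩,
    {v | v.1 ∈ accept₁ ∧ v.2.1 ∈ accept₂ ∧ v.2.2.1 = none ∧ v.2.2.2 = none}, p + .X + 1,
    fun y => ?_⟩
  simp only [Polynomial.eval_add,
    Polynomial.eval_one, Polynomial.eval_X, hh]
  erw [List.map_id, initList_machine]
  obtain ⟨hy, c, hc, hl, hv⟩ | ⟨x, hx, v₁, v₂, s₁, s₂, hv, hc, hz⟩ := hp true y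
  · refine ⟨c, hc.mono (by omega), hl, fun z => ?_⟩
    simp [hy, hv]
  · obtain ⟨z, hs₂⟩ : ∃ z : List A, s₂ M₂.tm.k₁ = z.map M₂.outputAlphabet.symm :=
      ⟨(s₂ M₂.tm.k₁).map M₂.outputAlphabet, by simp⟩
    obtain ⟨c, hc', hl, h₁, h₂, hb, hk⟩ := reaches_compare (accept₁ := accept₁) v₁ v₂ none none
      s₁ s₂ y [] [] x z hs₂
    refine ⟨c, (hc.trans hc').mono (by omega), hl, fun x' => ?_⟩
    have hmap : x'.map (Equiv.refl A).symm = x' := List.map_id x'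
    have hiff : x' ∈ g y ∧ y ∈ f x' ↔
        (c.var.1 ∈ accept₁ ∧ c.var.2.1 ∈ accept₂ ∧ c.var.2.2.1 = none ∧ c.var.2.2.2 = none) ∧
          c.stk (.inr (.inr 3)) = x'.map (Equiv.refl A).symm := by
      rw [hmap, h₁, h₂, hk, hb]
      constructor
      · rintro ⟨hx', hy⟩
        obtain rfl := Part.mem_unique hx hx'
        obtain ⟨h₁, h₂⟩ := (hz y).1 hy
        rw [hs₂] at h₂
        exact ⟨⟨hv, h₁, (List.map_injective_iff.2 M₂.outputAlphabet.symm.injective h₂).symm⟩, rfl⟩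
      · rintro ⟨⟨-, h₁, rfl⟩, rfl⟩
        exact ⟨hx, (hz _).2 ⟨h₁, hs₂⟩⟩
    exact hiff

theorem PolynomiallyBalanced.comp (hf : PolynomiallyBalanced f) (hg : PolynomiallyBalanced g) :
    PolynomiallyBalanced (f * g) := by
  obtain ⟨p, hp⟩ := hf
  obtain ⟨q, hq⟩ := hg
  refine ⟨p.comp q + q.comp p, fun x z hz => ?_⟩
  obtain ⟨y, hy, hz⟩ := mem_pfun_mul.1 hz
  have h₁ := hp y z hz
  have h₂ := hq x y hy
  have h₃ := p.eval_mono_nat h₂.1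
  have h₄ := q.eval_mono_nat h₁.2
  simp only [Polynomial.eval_add, Polynomial.eval_comp] at *
  omega

theorem mul_mem_fP [Fintype A] (hf : f ∈ fP A) (hg : g ∈ fP A) : f * g ∈ fP A :=
  ⟨hf.1.comp hg.1, hf.2.comp hg⟩

theorem one_mem_fP [Fintype A] : (1 : List A →. List A) ∈ fP A := by
  refine ⟨⟨.X, fun x y hy => ?_⟩, ⟨idComputer A, Equiv.refl A, Equiv.refl A⟩, Set.univ, 1,
    fun x => ?_⟩
  · obtain rfl := Part.mem_some_iff.1 hy
    simp
  · refine ⟨⟨none, (), fun _ => x⟩, ?_, rfl, fun y => ?_⟩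
    · rw [Polynomial.eval_one]
      refine ReachesWithin.single ?_
      rw [initList_eq]
      have h : x.map (Equiv.refl A) = x := List.map_id x
      refine congrArg (fun S => some (Cfg.mk none () S)) (funext fun k => ?_)
      exact (Function.update_self ..).trans h
    · have h : y.map (Equiv.refl A).symm = y := List.map_id y
      have h' : y ∈ (1 : List A →. List A) x ↔ True ∧ x = y.map (Equiv.refl A).symm := by
        rw [true_and, h, eq_comm]
        exact Part.mem_some_iff
      exact h'

/-! ### Inverses -/

/-- The restriction of `g` to the elements `y` with `f (g y) = y`. -/
def sectionOf (f g : List A →. List A) : List A →. List A :=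
  fun y => (g y).bind fun x => ⟨y ∈ f x, fun _ => x⟩

theorem mem_sectionOf {x y : List A} : x ∈ sectionOf f g y ↔ x ∈ g y ∧ y ∈ f x := by
  simp only [sectionOf, Part.mem_bind_iff]
  constructor
  · rintro ⟨x', hx', h, rfl⟩
    exact ⟨hx', h⟩
  · rintro ⟨hx, hy⟩
    exact ⟨x, hx, hy, rfl⟩

/-- By single-valuedness, the equation only asks that `g` choose a preimage for each value of `f`.
-/
theorem isInverseOf_iff : IsInverseOf g f ↔ ∀ x y, y ∈ f x → ∃ x' ∈ g y, y ∈ f x' := by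
  constructor
  · intro h x y hy
    have hy' : y ∈ (f * g * f) x := by rwa [h]
    obtain ⟨y', hy', h'⟩ := mem_pfun_mul.1 hy'
    obtain ⟨x', hx', h''⟩ := mem_pfun_mul.1 h'
    obtain rfl := Part.mem_unique hy hy'
    exact ⟨x', hx', h''⟩
  · intro h
    refine funext fun x => Part.ext fun z => ?_
    simp only [mem_pfun_mul]
    constructor
    · rintro ⟨y, hy, x', hx', hz⟩
      obtain ⟨x'', hx'', hy''⟩ := h x y hy
      obtain rfl := Part.mem_unique hx' hx''
      obtain rfl := Part.mem_unique hz hy''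
      exact hy
    · intro hz
      exact ⟨z, hz, h x z hz⟩

theorem isMutualInverseOf_sectionOf (h : IsInverseOf g f) :
    IsMutualInverseOf (sectionOf f g) f := by
  constructor
  · rw [isInverseOf_iff] at h ⊢
    intro x y hy
    obtain ⟨x', hx', hy'⟩ := h x y hy
    exact ⟨x', mem_sectionOf.2 ⟨hx', hy'⟩, hy'⟩
  · rw [isInverseOf_iff]
    intro y x hx
    exact ⟨y, (mem_sectionOf.1 hx).2, hx⟩

theorem sectionOf_mem_fP [Fintype A] (hf : f ∈ fP A) (hg : g ∈ fP A) : sectionOf f g ∈ fP A := by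
  refine ⟨?_, hf.2.restrict hg fun _ _ => mem_sectionOf⟩
  obtain ⟨p, hp⟩ := hg.1
  exact ⟨p, fun y x hx => hp y x (mem_sectionOf.1 hx).1⟩

/-- Injectivity: a value `x` determines its argument as `f x`. Regularity is witnessed by `f`
itself. -/
theorem sectionOf_mem_invfP [Fintype A] (hf : f ∈ fP A) (hg : g ∈ fP A) (h : IsInverseOf g f) :
    sectionOf f g ∈ invfP A :=
  ⟨fun _ _ _ h₁ h₂ => Part.mem_unique (mem_sectionOf.1 h₁).2 (mem_sectionOf.1 h₂).2,
    sectionOf_mem_fP hf hg, f, hf, (isMutualInverseOf_sectionOf h).2⟩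

/-- The mutual inverse of a partial injection is its converse relation. -/
theorem IsMutualInverseOf.mem_iff (hf : PartialInjective f) (hg : PartialInjective g)
    (h : IsMutualInverseOf g f) {x y : List A} : x ∈ g y ↔ y ∈ f x := by
  obtain ⟨h₁, h₂⟩ := h
  rw [isInverseOf_iff] at h₁ h₂
  constructor
  · intro hx
    obtain ⟨y', hy', hx'⟩ := h₂ y x hx
    rwa [hg hx hx']
  · intro hy
    obtain ⟨x', hx', hy'⟩ := h₁ x y hy
    rwa [hf hy hy']

theorem one_mem_invfP [Fintype A] : (1 : List A →. List A) ∈ invfP A := by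
  refine ⟨fun x₁ x₂ y h₁ h₂ => ?_, one_mem_fP, 1, one_mem_fP, ?_⟩
  · rw [← Part.mem_some_iff.1 h₁, ← Part.mem_some_iff.1 h₂]
  · simp [IsInverseOf]

theorem mul_mem_invfP [Fintype A] (hf : f ∈ invfP A) (hg : g ∈ invfP A) : f * g ∈ invfP A := by
  obtain ⟨hfi, hfP, f', hf', hff'⟩ := hf
  obtain ⟨hgi, hgP, g', hg', hgg'⟩ := hg
  refine ⟨fun x₁ x₂ z h₁ h₂ => ?_, mul_mem_fP hfP hgP, g' * f', mul_mem_fP hg' hf', ?_⟩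
  · obtain ⟨y₁, hy₁, hz₁⟩ := mem_pfun_mul.1 h₁
    obtain ⟨y₂, hy₂, hz₂⟩ := mem_pfun_mul.1 h₂
    obtain rfl := hfi hz₁ hz₂
    exact hgi hy₁ hy₂
  · rw [isInverseOf_iff] at *
    intro x z hz
    obtain ⟨y, hy, hz⟩ := mem_pfun_mul.1 hz
    obtain ⟨y', hy', hz'⟩ := hff' y z hz
    -- Injectivity of `f` is essential: the preimage chosen by `f'` must be `y`, a value of `g`, for
    -- `g'` to apply.
    obtain rfl := hfi hz hz'
    obtain ⟨x', hx', hy''⟩ := hgg' x y hy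
    exact ⟨x', mem_pfun_mul.2 ⟨y, hy', hx'⟩, mem_pfun_mul.2 ⟨y, hy'', hz⟩⟩

end PolyTime

theorem corollary2p3 (A : Type) [Fintype A] :
    (∃ M : Submonoid (List A →. List A),
      (M : Set (List A →. List A)) = invfP A ∧ IsInverseMonoid M) ∧
    (∀ f : List A →. List A, IsRegularElementOf (fP A) f →
      ∃ g ∈ invfP A, IsInverseOf g f) := by
  refine ⟨⟨⟨⟨invfP A, mul_mem_invfP⟩, one_mem_invfP⟩, rfl, ?_⟩, ?_⟩
  · rintro ⟨f, hf⟩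
    obtain ⟨hfi, hfP, g, hg, hgf⟩ := id hf
    have hmut := isMutualInverseOf_sectionOf hgf
    have hs := sectionOf_mem_invfP hfP hg hgf
    refine ⟨⟨sectionOf f g, hs⟩, ⟨Subtype.ext hmut.1, Subtype.ext hmut.2⟩, ?_⟩
    rintro ⟨g', hg'⟩ ⟨h₁, h₂⟩
    have hmut' : IsMutualInverseOf g' f := ⟨congrArg Subtype.val h₁, congrArg Subtype.val h₂⟩
    refine Subtype.ext (funext fun y => Part.ext fun x => ?_)
    -- Both mutual inverses are the converse of `f`.
    exact (hmut'.mem_iff hfi hg'.1).trans (hmut.mem_iff hfi hs.1).symm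
  · rintro f ⟨hf, g, hg, h⟩
    exact ⟨sectionOf f g, sectionOf_mem_invfP hf hg h, (isMutualInverseOf_sectionOf h).1⟩
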